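/- **Setting.** Let $(M,P,g)$ be a connected Riemannian almost product manifold of dimension $2n$, $n\ge 1$: $g$ is a smooth Riemannian metric and $P$ a smooth $(1,1)$-tensor field with $P^2=\mathrm{id}$, $g(Px,Py)=g(x,y)$ and $\operatorname{tr}P=0$. Let $\nabla$ be the Levi-Civita connection of $g$, $F(x,y,z)=g((\nabla_xP)y,z)$, $\theta(x)=g^{ij}F(e_i,e_j,x)$, and let $\Omega$ be defined by $g(\Omega,x)=\theta(x)$. Suppose $(M,P,g)$ is a $\mathcal W_1$-manifold, i.e. $$F(x,y,z)=\tfrac1{2n}\{g(x,y)\theta(z)-g(x,Py)\theta(Pz)+g(x,z)\theta(y)-g(x,Pz)\theta(Py)\}.$$ For real constants $\lambda,\mu$ let $D^{\lambda,\mu}$ be the connection $$D^{\lambda,\mu}_xy=\nabla_xy+g(x,Py)\{\lambda P\Omega+\mu\Omega\}-\{\lambda\theta(Py)+\mu\theta(y)\}Px+g(x,y)\{\lambda\Omega+(\mu+\tfrac1{2n})P\Omega\}-\{\lambda\theta(y)+(\mu+\tfrac1{2n})\theta(Py)\}x ,$$ and put $D=D^{0,0}$. (Different pairs $(\lambda,\mu)$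 may determine the same connection.) The classes $\overline{\mathcal W}_3$, $\overline{\mathcal W}_6$ are given by the following conditions, for all $A,B,\xi,\eta$ with $PA=A$, $PB=B$, $P\xi=-\xi$, $P\eta=-\eta$: $$\overline{\mathcal W}_3:\ F(A,B,\xi)=\tfrac1n g(A,B)\theta^v(\xi),\ F(\xi,\eta,A)=0;\qquad \overline{\mathcal W}_6:\ F(\xi,\eta,A)=\tfrac1n g(\xi,\eta)\theta^h(A),\ F(A,B,\xi)=0,$$ where $\theta^v=\frac12(\theta-\theta\circ P)$, $\theta^h=\frac12(\theta+\theta\circ P)$. Put $W(y,z)=\theta(Py)\theta(z)-\theta(y)\theta(Pz)$; $W=0$ means that $W$ vanishes identically on $M$, and $W\neq0$ that it does not. A $(0,4)$-tensor $L$ is a Riemannian $P$-tensor if $L(x,y,z,w)=-L(y,x,z,w)=-L(x,y,w,z)$, $L(x,y,z,w)+L(y,z,x,w)+L(z,x,y,w)=0$ and $L(x,y,Pz,Pw)=L(x,y,z,w)$. **Theorem 5.3.** Let $\nabla'$ be a natural connection ($\nabla'g=\nabla'P=0$) of the family $\{D^{\lambda,\mu}\}$ on the $\mathcal W_1$-manifold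 $(M,P,g)$. Suppose that its torsion $T'$ is parallel, $\nabla'T'=0$, and that its curvature tensor $R'(x,y,z,w)=g(R'(x,y)z,w)$ is a Riemannian $P$-tensor. Then $\nabla'=D^{\lambda,\mu}$ for a pair $(\lambda,\mu)$ of real numbers for which one of the following (mutually exclusive) cases holds: 1. $\lambda=\mu=0$, $W\neq0$, i.e. $\nabla'=D$, $(M,P,g)\notin\overline{\mathcal W}_3$ and $(M,P,g)\notin\overline{\mathcal W}_6$; 2. $\lambda=\mu=0$, $W=0$, i.e. $\nabla'=D$, $(M,P,g)\in\overline{\mathcal W}_3$ or $(M,P,g)\in\overline{\mathcal W}_6$; 3. $\lambda=0$, $\mu\neq0$, $W=0$, and $(M,P,g)\in\overline{\mathcal W}_3$ or $(M,P,g)\in\overline{\mathcal W}_6$; 4. $\lambda\neq0$, $\mu=0$, $W=0$, and $(M,P,g)\in\overline{\mathcal W}_3$ or $(M,P,g)\in\overline{\mathcal W}_6$. Moreover, if $W\neq0$ and $n\ge2$, then $(0,0)$ is the only pair $(\lambda,\mu)$ with $\nabla'=D^{\lambda,\mu}$. -/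

import Mathlib

open Bundle Module
open scoped Manifold ContDiff InnerProductSpace

noncomputable section

namespace W1Geometry

section Definitions

variable {E : Type*} [NormedAddCommGroup E] [NormedSpace ℝ E]
  {M : Type*} [TopologicalSpace M] [ChartedSpace E M]

/-- The vector field `X` is smooth at `p` (i.e. smooth near `p`, as far as germs are concerned). -/
def SmoothFieldAt [IsManifold 𝓘(ℝ, E) ∞ M] (X : ∀ q : M, TangentSpace 𝓘(ℝ, E) q) (p : M) : Prop :=
  ContMDiffAt 𝓘(ℝ, E) (𝓘(ℝ, E).prod 𝓘(ℝ, E)) ∞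
    (fun q => TotalSpace.mk' E (E := fun x : M => TangentSpace 𝓘(ℝ, E) x) q (X q)) p

variable [FiniteDimensional ℝ E] [IsManifold 𝓘(ℝ, E) ∞ M]
  [RiemannianBundle (fun x : M => TangentSpace 𝓘(ℝ, E) x)]
  [IsContMDiffRiemannianBundle 𝓘(ℝ, E) ∞ E (fun x : M => TangentSpace 𝓘(ℝ, E) x)]

variable (E M) in
/-- A linear connection on `M`; `nab Y p v` is `(∇_v Y)(p)`. -/
abbrev LinearConnection :=
  CovariantDerivative 𝓘(ℝ, E) E (fun x : M => TangentSpace 𝓘(ℝ, E) x)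

variable (E M) in
/-- A Riemannian almost product structure with vanishing trace on the Riemannian manifold `M`:
a smooth `(1,1)`-tensor field `P` with `P² = id`, `g(Px, Py) = g(x, y)` and `tr P = 0`. -/
structure AlmostProduct where
  P (p : M) : TangentSpace 𝓘(ℝ, E) p →L[ℝ] TangentSpace 𝓘(ℝ, E) p
  smooth : ContMDiff 𝓘(ℝ, E) (𝓘(ℝ, E).prod 𝓘(ℝ, E →L[ℝ] E)) ∞
    (fun p => TotalSpace.mk' (E →L[ℝ] E)
      (E := fun x : M => TangentSpace 𝓘(ℝ, E) x →L[ℝ] TangentSpace 𝓘(ℝ, E) x) p (P p))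
  sq (p : M) (v : TangentSpace 𝓘(ℝ, E) p) : P p (P p v) = v
  isometry (p : M) (v w : TangentSpace 𝓘(ℝ, E) p) : ⟪P p v, P p w⟫_ℝ = ⟪v, w⟫_ℝ
  trace_zero (p : M) : LinearMap.trace ℝ (TangentSpace 𝓘(ℝ, E) p) (P p).toLinearMap = 0

/-- `nab` is the Levi-Civita connection: metric and torsion-free. -/
def IsLeviCivita (nab : LinearConnection E M) : Prop :=
  nab.IsMetricCompatible (V := fun x : M => TangentSpace 𝓘(ℝ, E) x) ∧ nab.torsion = 0

/-- The vector field `PY`. -/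
def AlmostProduct.field (S : AlmostProduct E M) (Y : ∀ q : M, TangentSpace 𝓘(ℝ, E) q) :
    ∀ q : M, TangentSpace 𝓘(ℝ, E) q :=
  fun q => S.P q (Y q)

set_option linter.unusedSectionVars false in
theorem AlmostProduct.mdifferentiableAt_field (S : AlmostProduct E M)
    {Y : ∀ q : M, TangentSpace 𝓘(ℝ, E) q} {p : M} (hY : MDiffAt (T% Y) p) :
    MDiffAt (T% (S.field Y)) p :=
  MDifferentiableAt.clm_bundle_apply (F₁ := E) (F₂ := E)
    (E₁ := fun x : M => TangentSpace 𝓘(ℝ, E) x) (E₂ := fun x : M => TangentSpace 𝓘(ℝ, E) x)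
    (b := fun q : M => q) (ϕ := S.P) (v := Y)
    (S.smooth.mdifferentiableAt (by simp)) hY

/-- `(∇_v P) Y = ∇_v (P Y) - P (∇_v Y)` at `p`, as a linear map in `v`. -/
def nablaPField (nab : LinearConnection E M) (S : AlmostProduct E M) (p : M)
    (Y : ∀ q : M, TangentSpace 𝓘(ℝ, E) q) :
    TangentSpace 𝓘(ℝ, E) p →L[ℝ] TangentSpace 𝓘(ℝ, E) p :=
  nab (S.field Y) p - (S.P p).comp (nab Y p)

theorem tensorialAt_nablaPField (nab : LinearConnection E M) (S : AlmostProduct E M) (p : M) :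
    TensorialAt 𝓘(ℝ, E) E (nablaPField nab S p) p where
  smul {f Y} hf hY := by
    have h : S.field (f • Y) = f • S.field Y := by
      funext q; simp [AlmostProduct.field]
    ext v
    simp only [nablaPField, h, nab.isCovariantDerivativeOn.leibniz hY hf,
      nab.isCovariantDerivativeOn.leibniz (S.mdifferentiableAt_field hY) hf]
    simp [AlmostProduct.field]
    module
  add {Y Z} hY hZ := by
    have h : S.field (Y + Z) = S.field Y + S.field Z := by
      funext q; simp [AlmostProduct.field]
    ext v
    simp only [nablaPField, h, nab.isCovariantDerivativeOn.add hY hZ,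
      nab.isCovariantDerivativeOn.add (S.mdifferentiableAt_field hY) (S.mdifferentiableAt_field hZ)]
    simp
    module

/-- The tensor `∇P` at `p`: `nablaP nab S p y x = (∇_x P) y`. -/
def nablaP (nab : LinearConnection E M) (S : AlmostProduct E M) (p : M) :
    TangentSpace 𝓘(ℝ, E) p →L[ℝ] TangentSpace 𝓘(ℝ, E) p →L[ℝ] TangentSpace 𝓘(ℝ, E) p :=
  TensorialAt.mkHom (nablaPField nab S p) p (tensorialAt_nablaPField nab S p)

theorem nablaP_apply (nab : LinearConnection E M) (S : AlmostProduct E M) {p : M}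
    {Y : ∀ q : M, TangentSpace 𝓘(ℝ, E) q} (hY : MDiffAt (T% Y) p) (x : TangentSpace 𝓘(ℝ, E) p) :
    nablaP nab S p (Y p) x = nab (S.field Y) p x - S.P p (nab Y p x) := by
  unfold nablaP
  rw [TensorialAt.mkHom_apply _ hY]
  rfl

/-- A natural connection on `(M, P, g)`: `∇'g = 0` and `∇'P = 0`. -/
def IsNatural (nab' : LinearConnection E M) (S : AlmostProduct E M) : Prop :=
  nab'.IsMetricCompatible (V := fun x : M => TangentSpace 𝓘(ℝ, E) x) ∧ nablaP nab' S = 0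

/-! In the following definitions `nab` stands for the Levi-Civita connection. -/

instance instFiniteDimensionalTangent (p : M) : FiniteDimensional ℝ (TangentSpace 𝓘(ℝ, E) p) :=
  inferInstanceAs (FiniteDimensional ℝ E)

/-- `F(x, y, z) = g((∇_x P) y, z)`. -/
def tensorF (nab : LinearConnection E M) (S : AlmostProduct E M) (p : M)
    (x y z : TangentSpace 𝓘(ℝ, E) p) : ℝ :=
  ⟪nablaP nab S p y x, z⟫_ℝ

/-- The associated 1-form `θ(x) = g^{ij} F(e_i, e_j, x)`, computed in an orthonormal basis. -/
def theta (nab : LinearConnection E M) (S : AlmostProduct E M) (p : M)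
    (x : TangentSpace 𝓘(ℝ, E) p) : ℝ :=
  ∑ i, tensorF nab S p (stdOrthonormalBasis ℝ (TangentSpace 𝓘(ℝ, E) p) i)
    (stdOrthonormalBasis ℝ (TangentSpace 𝓘(ℝ, E) p) i) x

/-- The vector field `Ω` dual to `θ`, i.e. `Ω = g^{ij} (∇_{e_i} P) e_j`. -/
def Omega (nab : LinearConnection E M) (S : AlmostProduct E M) (p : M) :
    TangentSpace 𝓘(ℝ, E) p :=
  ∑ i, nablaP nab S p (stdOrthonormalBasis ℝ (TangentSpace 𝓘(ℝ, E) p) i)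
    (stdOrthonormalBasis ℝ (TangentSpace 𝓘(ℝ, E) p) i)

theorem inner_Omega (nab : LinearConnection E M) (S : AlmostProduct E M) (p : M)
    (x : TangentSpace 𝓘(ℝ, E) p) : ⟪Omega nab S p, x⟫_ℝ = theta nab S p x := by
  simp [Omega, theta, tensorF, sum_inner]

/-- The class `𝒲₁` (`dim M = 2n`). -/
def IsW1 (n : ℕ) (nab : LinearConnection E M) (S : AlmostProduct E M) : Prop :=
  ∀ (p : M) (x y z : TangentSpace 𝓘(ℝ, E) p),
    tensorF nab S p x y z = 1 / (2 * (n : ℝ)) *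
      (⟪x, y⟫_ℝ * theta nab S p z - ⟪x, S.P p y⟫_ℝ * theta nab S p (S.P p z)
        + ⟪x, z⟫_ℝ * theta nab S p y - ⟪x, S.P p z⟫_ℝ * theta nab S p (S.P p y))

/-- `θ^v(x) = (θ(x) - θ(Px)) / 2`. -/
def thetaV (nab : LinearConnection E M) (S : AlmostProduct E M) (p : M)
    (x : TangentSpace 𝓘(ℝ, E) p) : ℝ :=
  1 / 2 * (theta nab S p x - theta nab S p (S.P p x))

/-- `θ^h(x) = (θ(x) + θ(Px)) / 2`. -/
def thetaH (nab : LinearConnection E M) (S : AlmostProduct E M) (p : M)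
    (x : TangentSpace 𝓘(ℝ, E) p) : ℝ :=
  1 / 2 * (theta nab S p x + theta nab S p (S.P p x))

/-- The Naveira class `𝒲̄₃`: `F(A, B, ξ) = g(A, B) θ^v(ξ) / n` and `F(ξ, η, A) = 0` whenever
`PA = A`, `PB = B`, `Pξ = -ξ`, `Pη = -η`. -/
def IsW3bar (n : ℕ) (nab : LinearConnection E M) (S : AlmostProduct E M) : Prop :=
  ∀ (p : M) (a b ξ η : TangentSpace 𝓘(ℝ, E) p),
    S.P p a = a → S.P p b = b → S.P p ξ = -ξ → S.P p η = -η →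
    tensorF nab S p a b ξ = 1 / (n : ℝ) * ⟪a, b⟫_ℝ * thetaV nab S p ξ ∧
      tensorF nab S p ξ η a = 0

/-- The Naveira class `𝒲̄₆`: `F(ξ, η, A) = g(ξ, η) θ^h(A) / n` and `F(A, B, ξ) = 0` whenever
`PA = A`, `PB = B`, `Pξ = -ξ`, `Pη = -η`. -/
def IsW6bar (n : ℕ) (nab : LinearConnection E M) (S : AlmostProduct E M) : Prop :=
  ∀ (p : M) (a b ξ η : TangentSpace 𝓘(ℝ, E) p),
    S.P p a = a → S.P p b = b → S.P p ξ = -ξ → S.P p η = -η →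
    tensorF nab S p ξ η a = 1 / (n : ℝ) * ⟪ξ, η⟫_ℝ * thetaH nab S p a ∧
      tensorF nab S p a b ξ = 0

/-- `W(y, z) = θ(Py) θ(z) - θ(y) θ(Pz)`. -/
def tensorW (nab : LinearConnection E M) (S : AlmostProduct E M) (p : M)
    (y z : TangentSpace 𝓘(ℝ, E) p) : ℝ :=
  theta nab S p (S.P p y) * theta nab S p z - theta nab S p y * theta nab S p (S.P p z)

/-- `W = 0` identically on `M`. -/
def WVanishes (nab : LinearConnection E M) (S : AlmostProduct E M) : Prop :=
  ∀ (p : M) (y z : TangentSpace 𝓘(ℝ, E) p), tensorW nab S p y z = 0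

/-- `nab'` is the connection `D^{λ,μ}` (`lam = λ`, `mu = μ`) of the two-parameter family
`∇'_x y = ∇_x y + g(x,Py){λPΩ + μΩ} - {λθ(Py) + μθ(y)} Px
  + g(x,y){λΩ + (μ + 1/(2n))PΩ} - {λθ(y) + (μ + 1/(2n))θ(Py)} x`. -/
def HasParameters (n : ℕ) (nab nab' : LinearConnection E M) (S : AlmostProduct E M)
    (lam mu : ℝ) : Prop :=
  ∀ (p : M) (Y : ∀ q : M, TangentSpace 𝓘(ℝ, E) q), MDiffAt (T% Y) p →
    ∀ x : TangentSpace 𝓘(ℝ, E) p,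
      nab' Y p x = nab Y p x
        + ⟪x, S.P p (Y p)⟫_ℝ • (lam • S.P p (Omega nab S p) + mu • Omega nab S p)
        - (lam * theta nab S p (S.P p (Y p)) + mu * theta nab S p (Y p)) • S.P p x
        + ⟪x, Y p⟫_ℝ • (lam • Omega nab S p
            + (mu + 1 / (2 * (n : ℝ))) • S.P p (Omega nab S p))
        - (lam * theta nab S p (Y p)
            + (mu + 1 / (2 * (n : ℝ))) * theta nab S p (S.P p (Y p))) • x

/-- The torsion `T'` of `nab'` is parallel:
`(∇'_x T')(Y, Z) = ∇'_x (T'(Y, Z)) - T'(∇'_x Y, Z) - T'(Y, ∇'_x Z) = 0`. -/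
def HasParallelTorsion (nab' : LinearConnection E M) : Prop :=
  ∀ (p : M) (Y Z : ∀ q : M, TangentSpace 𝓘(ℝ, E) q), SmoothFieldAt Y p → SmoothFieldAt Z p →
    ∀ x : TangentSpace 𝓘(ℝ, E) p,
      nab' (fun q => nab'.torsion q (Y q) (Z q)) p x
        - nab'.torsion p (nab' Y p x) (Z p) - nab'.torsion p (Y p) (nab' Z p x) = 0

/-- The curvature operator `R(X,Y)Z = ∇_X ∇_Y Z - ∇_Y ∇_X Z - ∇_{[X,Y]} Z`. -/
def curvature (nab' : LinearConnection E M) (X Y Z : ∀ q : M, TangentSpace 𝓘(ℝ, E) q) (p : M) :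
    TangentSpace 𝓘(ℝ, E) p :=
  nab' (fun q => nab' Z q (Y q)) p (X p) - nab' (fun q => nab' Z q (X q)) p (Y p)
    - nab' Z p (VectorField.mlieBracket 𝓘(ℝ, E) X Y p)

/-- The curvature tensor of type `(0,4)`: `R(X,Y,Z,U) = g(R(X,Y)Z, U)`. -/
def curvature4 (nab' : LinearConnection E M) (X Y Z U : ∀ q : M, TangentSpace 𝓘(ℝ, E) q)
    (p : M) : ℝ :=
  ⟪curvature nab' X Y Z p, U p⟫_ℝ

/-- The curvature of `nab'` is a Riemannian `P`-tensor: it is curvature-like and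
`R(X,Y,PZ,PU) = R(X,Y,Z,U)`. -/
def HasRiemannianPCurvature (nab' : LinearConnection E M) (S : AlmostProduct E M) : Prop :=
  ∀ (p : M) (X Y Z U : ∀ q : M, TangentSpace 𝓘(ℝ, E) q),
    SmoothFieldAt X p → SmoothFieldAt Y p → SmoothFieldAt Z p → SmoothFieldAt U p →
    curvature4 nab' X Y Z U p = -curvature4 nab' Y X Z U p ∧
    curvature4 nab' X Y Z U p = -curvature4 nab' X Y U Z p ∧
    curvature4 nab' X Y Z U p + curvature4 nab' Y Z X U p + curvature4 nab' Z X Y U p = 0 ∧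
    curvature4 nab' X Y (S.field Z) (S.field U) p = curvature4 nab' X Y Z U p

end Definitions

end W1Geometry

end

/-! Write $\Omega = \frac12(a + \xi)$ with $a = \Omega + P\Omega$ and $\xi = \Omega - P\Omega$ in
the two eigenbundles of $P$. At each point $W = 0$ says that $\Omega$ and $P\Omega$ are
proportional, that is, $a = 0$ or $\xi = 0$.

If $W \ne 0$ at some point, parallel torsion turns the first Bianchi identity into: cyclic sum of
$R'$ equals minus the cyclic sum of $T'(x, T'(y,z))$. The left side vanishes for a Riemannian
$P$-tensor. Testing the right side on $a, \xi$ and a third eigenvector orthogonal to both gives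
$\lambda + \mu = 0$ and $\lambda - \mu = 0$ (`HasParameters.eq_zero_of_not_wVanishes`). The third
vector needs $n \ge 2$; for $n = 1$ the whole family is one connection
(`HasParameters.zero_of_dim_two`).

If $W = 0$, parallel torsion forces $\nabla'\Omega = 0$ (`HasParameters.nabla_Omega`), so
$g(\Omega,\Omega)$ and $g(P\Omega,\Omega)$ are constant on the connected $M$ and $P\Omega =
\varepsilon\Omega$ with one global sign (`P_Omega_of_wVanishes`). The sign decides the Naveira
class, and $D^{\lambda,\mu} = D^{0,\varepsilon\lambda+\mu}$ (`HasParameters.of_P_Omega`). -/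

namespace W1Geometry

variable {E : Type*} [NormedAddCommGroup E] [NormedSpace ℝ E]
  {M : Type*} [TopologicalSpace M] [ChartedSpace E M]

/-! ### Germs of smooth vector fields -/

section Fields

variable [IsManifold 𝓘(ℝ, E) ∞ M]

theorem exists_smoothFieldAt_eq {p : M} (v : TangentSpace 𝓘(ℝ, E) p) :
    ∃ X : ∀ q : M, TangentSpace 𝓘(ℝ, E) q, SmoothFieldAt X p ∧ X p = v :=
  ⟨FiberBundle.extend E v, FiberBundle.contMDiffAt_extend _ _ v, by simp⟩

namespace SmoothFieldAt

variable {X Y : ∀ q : M, TangentSpace 𝓘(ℝ, E) q} {p : M}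

theorem mdifferentiableAt (hX : SmoothFieldAt X p) : MDiffAt (T% X) p :=
  ContMDiffAt.mdifferentiableAt hX (by simp)

theorem eventually_mdifferentiableAt (hX : SmoothFieldAt X p) :
    ∀ᶠ q in nhds p, MDiffAt (T% X) q := by
  -- Order `∞` at a point only gives, for each finite order, some neighbourhood; passing to order 1
  -- fixes one.
  have h1 : ContMDiffAt 𝓘(ℝ, E) (𝓘(ℝ, E).prod 𝓘(ℝ, E)) 1 (T% X) p :=
    ContMDiffAt.of_le hX (by simp)
  have : IsManifold 𝓘(ℝ, E) (1 + 1) M := IsManifold.of_le (n := ∞) (by norm_cast)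
  filter_upwards [(contMDiffAt_iff_contMDiffAt_nhds (by simp)).1 h1] with q hq
  exact hq.mdifferentiableAt (by simp)

theorem congr (hX : SmoothFieldAt X p) (h : ∀ᶠ q in nhds p, Y q = X q) : SmoothFieldAt Y p := by
  refine ContMDiffAt.congr_of_eventuallyEq hX ?_
  filter_upwards [h] with q hq
  rw [hq]

theorem add (hX : SmoothFieldAt X p) (hY : SmoothFieldAt Y p) :
    SmoothFieldAt (fun q => X q + Y q) p :=
  ContMDiffAt.add_section hX hY

theorem sub (hX : SmoothFieldAt X p) (hY : SmoothFieldAt Y p) :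
    SmoothFieldAt (fun q => X q - Y q) p :=
  ContMDiffAt.sub_section hX hY

theorem smul {f : M → ℝ} (hf : ContMDiffAt 𝓘(ℝ, E) 𝓘(ℝ, ℝ) ∞ f p) (hX : SmoothFieldAt X p) :
    SmoothFieldAt (fun q => f q • X q) p :=
  ContMDiffAt.smul_section hf hX

theorem const_smul (c : ℝ) (hX : SmoothFieldAt X p) : SmoothFieldAt (fun q => c • X q) p :=
  smul contMDiffAt_const hX

theorem mlieBracket [CompleteSpace E] (hX : SmoothFieldAt X p) (hY : SmoothFieldAt Y p) :
    SmoothFieldAt (VectorField.mlieBracket 𝓘(ℝ, E) X Y) p :=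
  have : IsManifold 𝓘(ℝ, E) (minSmoothness ℝ 2) M := by
    rw [minSmoothness_of_isRCLikeNormedField]; infer_instance
  have : IsManifold 𝓘(ℝ, E) (∞ + 1) M := inferInstanceAs (IsManifold 𝓘(ℝ, E) ∞ M)
  ContMDiffAt.mlieBracket_vectorField (n := ⊤) (m := ⊤) hX hY (by simp)

theorem mvfderiv {f : M → ℝ} (hX : SmoothFieldAt X p)
    (hf : ContMDiffAt 𝓘(ℝ, E) 𝓘(ℝ, ℝ) ∞ f p) :
    ContMDiffAt 𝓘(ℝ, E) 𝓘(ℝ, ℝ) ∞ (fun q => d% f q (X q)) p := by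
  have h1 := hf.mfderiv_const (m := ∞) (by simp)
  have h2 := ContMDiffAt.clm_apply_of_inCoordinates (n := ∞) (F₁ := E) (F₂ := ℝ)
    (E₁ := fun q : M => TangentSpace 𝓘(ℝ, E) q) (E₂ := fun t : ℝ => TangentSpace 𝓘(ℝ, ℝ) t)
    (b₁ := fun q : M => q) (b₂ := f) (ϕ := fun q => mfderiv 𝓘(ℝ, E) 𝓘(ℝ, ℝ) f q) (v := X)
    h1 hX hf
  rw [contMDiffAt_totalSpace] at h2
  refine h2.2.congr_of_eventuallyEq ?_
  filter_upwards with q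
  simp [_root_.mvfderiv]
  rfl

end SmoothFieldAt

end Fields

/-! ### Smoothness of the Levi-Civita connection -/

section Metric

variable [IsManifold 𝓘(ℝ, E) ∞ M]
  [RiemannianBundle (fun x : M => TangentSpace 𝓘(ℝ, E) x)]
  {X Y Z : ∀ q : M, TangentSpace 𝓘(ℝ, E) q} {p : M}

theorem SmoothFieldAt.field (S : AlmostProduct E M) (hX : SmoothFieldAt X p) :
    SmoothFieldAt (S.field X) p :=
  ContMDiffAt.clm_bundle_apply (F₁ := E) (F₂ := E)
    (E₁ := fun x : M => TangentSpace 𝓘(ℝ, E) x) (E₂ := fun x : M => TangentSpace 𝓘(ℝ, E) x)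
    (b := fun q : M => q) (ϕ := S.P) (v := X) (S.smooth p) hX

variable
  [IsContMDiffRiemannianBundle 𝓘(ℝ, E) ∞ E (fun x : M => TangentSpace 𝓘(ℝ, E) x)]

theorem SmoothFieldAt.inner (hX : SmoothFieldAt X p) (hY : SmoothFieldAt Y p) :
    ContMDiffAt 𝓘(ℝ, E) 𝓘(ℝ, ℝ) ∞ (fun q => ⟪X q, Y q⟫_ℝ) p :=
  ContMDiffAt.inner_bundle (b := fun q : M => q) hX hY

variable [FiniteDimensional ℝ E]

/-- A vector field is smooth if its inner products with all smooth vector fields are smooth. -/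
theorem SmoothFieldAt.of_inner
    (h : ∀ Z : ∀ q : M, TangentSpace 𝓘(ℝ, E) q, SmoothFieldAt Z p →
      ContMDiffAt 𝓘(ℝ, E) 𝓘(ℝ, ℝ) ∞ (fun q => ⟪X q, Z q⟫_ℝ) p) : SmoothFieldAt X p := by
  classical
  set t := trivializationAt E (fun x : M => TangentSpace 𝓘(ℝ, E) x) p with ht
  have hpt : p ∈ t.baseSet := FiberBundle.mem_baseSet_trivializationAt' p
  let b := Module.finBasis ℝ E
  let Z : Fin (finrank ℝ E) → ∀ q : M, TangentSpace 𝓘(ℝ, E) q := fun i q => t.symmL ℝ q (b i)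
  have hZ : ∀ i, SmoothFieldAt (Z i) p := by
    intro i
    refine (Bundle.contMDiffAt_section _).2 ?_
    refine (contMDiffAt_const (c := b i)).congr_of_eventuallyEq ?_
    filter_upwards [t.open_baseSet.mem_nhds hpt] with q hq
    simp only [Z]
    rw [t.symmL_apply hq, t.apply_mk_symm hq]
  -- The Gram operator of the local frame `Z`. It sends the coordinates of `X` to the vector `w` of
  -- inner products with the frame, so smoothness of `X` follows by inverting it; positive
  -- definiteness makes it injective.
  let A : M → E →L[ℝ] E := fun q => ∑ i, ∑ j, ⟪Z i q, Z j q⟫_ℝ •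
    (LinearMap.toContinuousLinearMap (b.coord j)).smulRight (b i)
  have hA : ContMDiffAt 𝓘(ℝ, E) 𝓘(ℝ, E →L[ℝ] E) ∞ A p := by
    refine contMDiffAt_finsetSum fun i _ => contMDiffAt_finsetSum fun j _ => ?_
    exact ((hZ i).inner (hZ j)).smul contMDiffAt_const
  let w : M → E := fun q => ∑ i, ⟪X q, Z i q⟫_ℝ • b i
  have hw : ContMDiffAt 𝓘(ℝ, E) 𝓘(ℝ, E) ∞ w p := by
    refine contMDiffAt_finsetSum fun i _ => ?_
    exact (h _ (hZ i)).smul contMDiffAt_const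
  have hexp : ∀ (q : M) (u : E), t.symmL ℝ q u = ∑ j, b.repr u j • Z j q := by
    intro q u
    conv_lhs => rw [← b.sum_repr u, map_sum]
    simp only [map_smul, Z]
  have hAu : ∀ q ∈ t.baseSet, ∀ u : E, A q u = ∑ i, ⟪Z i q, t.symmL ℝ q u⟫_ℝ • b i := by
    intro q hq u
    have hu := hexp q u
    simp only [A, sum_apply, hu, inner_sum, inner_smul_right,
      Finset.sum_smul]
    refine Finset.sum_congr rfl fun i _ => Finset.sum_congr rfl fun j _ => ?_
    simp [smul_smul, mul_comm]
  have hinj : ∀ q ∈ t.baseSet, Function.Injective (A q) := by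
    intro q hq
    rw [injective_iff_map_eq_zero]
    intro u hu
    rw [hAu q hq] at hu
    have h0 : ∀ i, ⟪Z i q, t.symmL ℝ q u⟫_ℝ = 0 := by
      intro i
      exact Fintype.linearIndependent_iff.1 b.linearIndependent _ hu i
    have h1 : ⟪t.symmL ℝ q u, t.symmL ℝ q u⟫_ℝ = 0 := by
      nth_rw 1 [hexp q u]
      simp [sum_inner, inner_smul_left, h0]
    rw [inner_self_eq_zero] at h1
    have := t.continuousLinearMapAt_symmL (R := ℝ) hq u
    rw [h1, map_zero] at this
    exact this.symm
  have hinv : ∀ q ∈ t.baseSet, ∃ e : E ≃L[ℝ] E, (e : E →L[ℝ] E) = A q := by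
    intro q hq
    refine ⟨(LinearEquiv.ofInjectiveEndo (A q).toLinearMap (hinj q hq)).toContinuousLinearEquiv, ?_⟩
    ext u; rfl
  have hAX : ∀ q ∈ t.baseSet, (A q).inverse (w q) = (t ⟨q, X q⟩).2 := by
    intro q hq
    obtain ⟨e, he⟩ := hinv q hq
    have : w q = A q (t ⟨q, X q⟩).2 := by
      rw [hAu q hq]
      refine Finset.sum_congr rfl fun i _ => ?_
      rw [t.symmL_apply hq, t.symm_proj_apply ⟨q, X q⟩ hq, real_inner_comm]
    rw [this, ← he, ContinuousLinearMap.inverse_equiv]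
    simp
  have hAinv : ContMDiffAt 𝓘(ℝ, E) 𝓘(ℝ, E →L[ℝ] E) ∞ (fun q => (A q).inverse) p := by
    obtain ⟨e, he⟩ := hinv p hpt
    have h2 : ContDiffAt ℝ ∞ (ContinuousLinearMap.inverse (R := ℝ) (M := E) (M₂ := E)) (A p) := by
      rw [← he]; exact contDiffAt_map_inverse e
    exact h2.contMDiffAt.comp p hA
  refine (Bundle.contMDiffAt_section _).2 ?_
  refine (hAinv.clm_apply hw).congr_of_eventuallyEq ?_
  filter_upwards [t.open_baseSet.mem_nhds hpt] with q hq
  exact (hAX q hq).symm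

/-- Expand the three derivatives by metric compatibility and the three brackets by vanishing
torsion. A `LinearConnection` carries no smoothness of its own; for the Levi-Civita connection it is
read off from the right-hand side. -/
theorem koszul {nab : LinearConnection E M} (hLC : IsLeviCivita nab)
    (hX : MDiffAt (T% X) p) (hY : MDiffAt (T% Y) p) (hZ : MDiffAt (T% Z) p) :
    2 * ⟪nab Y p (X p), Z p⟫_ℝ =
      d% (fun q => ⟪Y q, Z q⟫_ℝ) p (X p) + d% (fun q => ⟪Z q, X q⟫_ℝ) p (Y p)
        - d% (fun q => ⟪X q, Y q⟫_ℝ) p (Z p)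
        + ⟪VectorField.mlieBracket 𝓘(ℝ, E) X Y p, Z p⟫_ℝ
        - ⟪VectorField.mlieBracket 𝓘(ℝ, E) Y Z p, X p⟫_ℝ
        - ⟪VectorField.mlieBracket 𝓘(ℝ, E) X Z p, Y p⟫_ℝ := by
  obtain ⟨hm, ht⟩ := hLC
  rw [CovariantDerivative.torsion_eq_zero_iff] at ht
  rw [← ht hX hY, ← ht hY hZ, ← ht hX hZ, hm.mvfderiv_inner_eq X hY hZ,
    hm.mvfderiv_inner_eq Y hZ hX, hm.mvfderiv_inner_eq Z hX hY]
  simp only [inner_sub_left]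
  rw [real_inner_comm (Z p) (nab X p (Y p)), real_inner_comm (nab Z p (X p)) (Y p),
    real_inner_comm (nab Y p (Z p)) (X p)]
  ring

theorem IsLeviCivita.smoothFieldAt {nab : LinearConnection E M} (hLC : IsLeviCivita nab)
    (hX : SmoothFieldAt X p) (hY : SmoothFieldAt Y p) :
    SmoothFieldAt (fun q => nab Y q (X q)) p := by
  refine SmoothFieldAt.of_inner fun Z hZ => ?_
  have h := (contMDiffAt_const (c := (1 / 2 : ℝ))).mul ((((((hX.mvfderiv (hY.inner hZ)).add (hY.mvfderiv (hZ.inner hX))).sub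
    (hZ.mvfderiv (hX.inner hY))).add ((hX.mlieBracket hY).inner hZ)).sub
    ((hY.mlieBracket hZ).inner hX)).sub ((hX.mlieBracket hZ).inner hY))
  refine h.congr_of_eventuallyEq ?_
  filter_upwards [hX.eventually_mdifferentiableAt, hY.eventually_mdifferentiableAt,
    hZ.eventually_mdifferentiableAt] with q hXq hYq hZq
  have := koszul hLC hXq hYq hZq
  simp only [Pi.mul_apply, Pi.add_apply]
  linear_combination (1 / 2) * this

end Metric

set_option linter.unusedSectionVars false

/-! ### Traceless involutions -/

section LinearAlgebra

variable {V : Type*} [NormedAddCommGroup V] [InnerProductSpace ℝ V] [FiniteDimensional ℝ V]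

/-- The fixed space of a traceless involution of a `2n`-dimensional space has dimension `n`. -/
theorem finrank_fixed_of_involution {P : V →ₗ[ℝ] V} {n : ℕ} (hP : ∀ v, P (P v) = v)
    (htr : LinearMap.trace ℝ V P = 0) (hdim : finrank ℝ V = 2 * n) :
    finrank ℝ (LinearMap.ker (P - LinearMap.id)) = n := by
  -- The rank of the projection $\frac12(1 + P)$ is its trace.
  have hproj : LinearMap.IsProj (LinearMap.ker (P - LinearMap.id))
      ((1 / 2 : ℝ) • (LinearMap.id + P)) := by
    refine ⟨fun v => ?_, fun v hv => ?_⟩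
    · rw [LinearMap.mem_ker]
      simp [hP]
      module
    · rw [LinearMap.mem_ker, LinearMap.sub_apply, LinearMap.id_apply, sub_eq_zero] at hv
      simp only [LinearMap.smul_apply, LinearMap.add_apply, LinearMap.id_apply, hv]
      module
  have h := hproj.trace
  rw [map_smul, map_add, LinearMap.trace_id, htr, hdim] at h
  have h' : (n : ℝ) = finrank ℝ (LinearMap.ker (P - LinearMap.id)) := by
    rw [← h]; push_cast; simp
  exact_mod_cast h'.symm

theorem exists_fixed_ne_zero_of_involution {P : V →ₗ[ℝ] V} {n : ℕ} (hP : ∀ v, P (P v) = v)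
    (htr : LinearMap.trace ℝ V P = 0) (hdim : finrank ℝ V = 2 * n) (hn : 1 ≤ n) :
    ∃ a, a ≠ 0 ∧ P a = a := by
  have h := finrank_fixed_of_involution hP htr hdim
  have : Nontrivial (LinearMap.ker (P - LinearMap.id)) :=
    Module.nontrivial_of_finrank_pos (R := ℝ) (by omega)
  obtain ⟨⟨a, ha⟩, ha0⟩ := exists_ne (0 : LinearMap.ker (P - LinearMap.id))
  refine ⟨a, fun h0 => ha0 (Subtype.ext h0), ?_⟩
  rwa [LinearMap.mem_ker, LinearMap.sub_apply, LinearMap.id_apply, sub_eq_zero] at ha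

theorem exists_fixed_orthogonal_of_involution {P : V →ₗ[ℝ] V} {n : ℕ} (hP : ∀ v, P (P v) = v)
    (htr : LinearMap.trace ℝ V P = 0) (hdim : finrank ℝ V = 2 * n) (hn : 2 ≤ n) (w : V) :
    ∃ a, a ≠ 0 ∧ P a = a ∧ ⟪a, w⟫_ℝ = 0 := by
  have h := finrank_fixed_of_involution hP htr hdim
  let f : LinearMap.ker (P - LinearMap.id) →ₗ[ℝ] ℝ :=
    (innerₛₗ ℝ w).comp (LinearMap.ker (P - LinearMap.id)).subtype
  have hf : 0 < finrank ℝ (LinearMap.ker f) := by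
    have h1 := f.finrank_range_add_finrank_ker
    have h2 : finrank ℝ (LinearMap.range f) ≤ 1 := by
      simpa using Submodule.finrank_le (LinearMap.range f)
    omega
  have : Nontrivial (LinearMap.ker f) := Module.nontrivial_of_finrank_pos (R := ℝ) hf
  obtain ⟨⟨⟨a, ha⟩, haf⟩, ha0⟩ := exists_ne (0 : LinearMap.ker f)
  refine ⟨a, fun h0 => ha0 (Subtype.ext (Subtype.ext h0)), ?_, ?_⟩
  · rwa [LinearMap.mem_ker, LinearMap.sub_apply, LinearMap.id_apply, sub_eq_zero] at ha
  · rw [real_inner_comm]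
    exact haf

/-- In dimension two the fixed space is a line, so `a` and `u` are multiples of one vector. -/
theorem inner_smul_comm_of_involution {P : V →ₗ[ℝ] V} (hP : ∀ v, P (P v) = v)
    (htr : LinearMap.trace ℝ V P = 0) (hdim : finrank ℝ V = 2) {a u : V}
    (ha : P a = a) (b : V) (hu : P u = u) :
    ⟪a, b⟫_ℝ • u = ⟪u, b⟫_ℝ • a := by
  have h := finrank_fixed_of_involution (n := 1) hP htr (by omega)
  obtain ⟨⟨e, he⟩, -, hspan⟩ := finrank_eq_one_iff'.1 h
  have hmem : ∀ v, P v = v → ∃ c : ℝ, c • e = v := by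
    intro v hv
    obtain ⟨c, hc⟩ := hspan ⟨v, by simp [hv]⟩
    exact ⟨c, congrArg Subtype.val hc⟩
  obtain ⟨ca, rfl⟩ := hmem a ha
  obtain ⟨cu, rfl⟩ := hmem u hu
  simp only [inner_smul_left, smul_smul]
  congr 1
  simp
  ring

end LinearAlgebra

variable {E : Type*} [NormedAddCommGroup E] [NormedSpace ℝ E] [FiniteDimensional ℝ E]
  {M : Type*} [TopologicalSpace M] [ChartedSpace E M] [IsManifold 𝓘(ℝ, E) ∞ M]
  [RiemannianBundle (fun x : M => TangentSpace 𝓘(ℝ, E) x)]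

/-! ### Eigenspaces of `P` in a tangent space -/

namespace AlmostProduct

variable (S : AlmostProduct E M) {n : ℕ} {p : M}

theorem inner_P_left (v w : TangentSpace 𝓘(ℝ, E) p) : ⟪S.P p v, w⟫_ℝ = ⟪v, S.P p w⟫_ℝ := by
  rw [← S.isometry p v (S.P p w), S.sq]

theorem inner_eq_zero {a ξ : TangentSpace 𝓘(ℝ, E) p} (ha : S.P p a = a) (hξ : S.P p ξ = -ξ) :
    ⟪a, ξ⟫_ℝ = 0 := by
  have h := S.isometry p a ξ
  rw [ha, hξ, inner_neg_right] at h
  linarith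

theorem trace_neg : LinearMap.trace ℝ (TangentSpace 𝓘(ℝ, E) p) (-(S.P p).toLinearMap) = 0 := by
  rw [map_neg, S.trace_zero, neg_zero]

theorem neg_sq (v : TangentSpace 𝓘(ℝ, E) p) :
    (-(S.P p).toLinearMap) ((-(S.P p).toLinearMap) v) = v := by
  simp [S.sq]

theorem exists_fixed (hn : 1 ≤ n) (hdim : finrank ℝ E = 2 * n) (p : M) :
    ∃ a : TangentSpace 𝓘(ℝ, E) p, a ≠ 0 ∧ S.P p a = a :=
  exists_fixed_ne_zero_of_involution (V := TangentSpace 𝓘(ℝ, E) p) (S.sq p) (S.trace_zero p)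
    hdim hn

theorem exists_antifixed (hn : 1 ≤ n) (hdim : finrank ℝ E = 2 * n) (p : M) :
    ∃ ξ : TangentSpace 𝓘(ℝ, E) p, ξ ≠ 0 ∧ S.P p ξ = -ξ := by
  obtain ⟨ξ, h0, h⟩ := exists_fixed_ne_zero_of_involution (V := TangentSpace 𝓘(ℝ, E) p)
    S.neg_sq S.trace_neg hdim hn
  exact ⟨ξ, h0, neg_eq_iff_eq_neg.1 h⟩

theorem exists_fixed_orthogonal (hn : 2 ≤ n) (hdim : finrank ℝ E = 2 * n)
    (w : TangentSpace 𝓘(ℝ, E) p) :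
    ∃ a : TangentSpace 𝓘(ℝ, E) p, a ≠ 0 ∧ S.P p a = a ∧ ⟪a, w⟫_ℝ = 0 :=
  exists_fixed_orthogonal_of_involution (V := TangentSpace 𝓘(ℝ, E) p) (S.sq p) (S.trace_zero p)
    hdim hn w

theorem exists_antifixed_orthogonal (hn : 2 ≤ n) (hdim : finrank ℝ E = 2 * n)
    (w : TangentSpace 𝓘(ℝ, E) p) :
    ∃ ξ : TangentSpace 𝓘(ℝ, E) p, ξ ≠ 0 ∧ S.P p ξ = -ξ ∧ ⟪ξ, w⟫_ℝ = 0 := by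
  obtain ⟨ξ, h0, h, hw⟩ := exists_fixed_orthogonal_of_involution (V := TangentSpace 𝓘(ℝ, E) p)
    S.neg_sq S.trace_neg hdim hn w
  exact ⟨ξ, h0, neg_eq_iff_eq_neg.1 h, hw⟩

/-- In dimension two the two-parameter family of connections is a single connection. -/
theorem inner_smul_cancel (hdim : finrank ℝ E = 2) (u x y : TangentSpace 𝓘(ℝ, E) p) :
    ⟪x, S.P p y⟫_ℝ • u - ⟪u, y⟫_ℝ • S.P p x + ⟪x, y⟫_ℝ • S.P p u - ⟪u, S.P p y⟫_ℝ • x = 0 := by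
  have key : ∀ v : TangentSpace 𝓘(ℝ, E) p, S.P p (v + S.P p v) = v + S.P p v := fun v => by
    rw [map_add, S.sq, add_comm]
  have key' : ∀ v : TangentSpace 𝓘(ℝ, E) p,
      (-(S.P p).toLinearMap) (v - S.P p v) = v - S.P p v := fun v => by
    simp [S.sq]
  have h1 := inner_smul_comm_of_involution (V := TangentSpace 𝓘(ℝ, E) p) (S.sq p)
    (S.trace_zero p) hdim (key x) (y + S.P p y) (key u)
  have h2 := inner_smul_comm_of_involution (V := TangentSpace 𝓘(ℝ, E) p) S.neg_sq
    S.trace_neg hdim (key' x) (y - S.P p y) (key' u)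
  simp only [inner_add_left, inner_add_right, inner_sub_left, inner_sub_right, S.inner_P_left,
    S.sq] at h1 h2
  -- `h1` and `h2` are the line identities on the two eigenspaces, for doubled projections; each
  -- inner product of these contributes another factor 2, whence $1/4$.
  have h3 := congr((1 / 4 : ℝ) • $h1 - (1 / 4 : ℝ) • $h2)
  rw [← sub_eq_zero] at h3
  refine Eq.trans ?_ h3
  module

end AlmostProduct

/-! ### Smoothness of `Omega` -/

section Omega

variable [IsContMDiffRiemannianBundle 𝓘(ℝ, E) ∞ E (fun x : M => TangentSpace 𝓘(ℝ, E) x)]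
  {S : AlmostProduct E M} {n : ℕ} {p : M} {nab : LinearConnection E M}
  {X Y : ∀ q : M, TangentSpace 𝓘(ℝ, E) q}

theorem theta_eq_inner (x : TangentSpace 𝓘(ℝ, E) p) :
    theta nab S p x = ⟪Omega nab S p, x⟫_ℝ := (inner_Omega nab S p x).symm

theorem IsLeviCivita.smoothFieldAt_nablaP (hLC : IsLeviCivita nab)
    (hX : SmoothFieldAt X p) (hY : SmoothFieldAt Y p) :
    SmoothFieldAt (fun q => nablaP nab S q (Y q) (X q)) p := by
  refine ((hLC.smoothFieldAt hX (hY.field S)).sub ((hLC.smoothFieldAt hX hY).field S)).congr ?_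
  filter_upwards [hY.eventually_mdifferentiableAt] with q hq
  exact nablaP_apply nab S hq (X q)

/-- On a fixed vector the $\mathcal W_1$ formula keeps only the $(-1)$-part of $\Omega$;
`IsW1.nablaP_antifixed` recovers the $(+1)$-part. -/
theorem IsW1.nablaP_fixed (hW1 : IsW1 n nab S) (hn : 1 ≤ n) {a : TangentSpace 𝓘(ℝ, E) p}
    (ha : S.P p a = a) :
    (2 * n : ℝ) • nablaP nab S p a a = ‖a‖ ^ 2 • (Omega nab S p - S.P p (Omega nab S p)) := by
  have hn' : (n : ℝ) ≠ 0 := by positivity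
  refine ext_inner_right ℝ fun z => ?_
  have h := hW1 p a a z
  rw [tensorF] at h
  rw [inner_smul_left, h]
  simp only [theta_eq_inner, ← S.inner_P_left, ha, inner_smul_left, inner_sub_left,
    real_inner_self_eq_norm_sq]
  simp
  field_simp

theorem IsW1.nablaP_antifixed (hW1 : IsW1 n nab S) (hn : 1 ≤ n) {ξ : TangentSpace 𝓘(ℝ, E) p}
    (hξ : S.P p ξ = -ξ) :
    (2 * n : ℝ) • nablaP nab S p ξ ξ = ‖ξ‖ ^ 2 • (Omega nab S p + S.P p (Omega nab S p)) := by
  have hn' : (n : ℝ) ≠ 0 := by positivity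
  refine ext_inner_right ℝ fun z => ?_
  have h := hW1 p ξ ξ z
  rw [tensorF] at h
  rw [inner_smul_left, h]
  simp only [theta_eq_inner, ← S.inner_P_left, hξ, inner_smul_left, inner_add_left,
    real_inner_self_eq_norm_sq]
  simp
  field_simp

theorem exists_smooth_fixed (S : AlmostProduct E M) {a : TangentSpace 𝓘(ℝ, E) p}
    (ha : S.P p a = a) :
    ∃ A : ∀ q : M, TangentSpace 𝓘(ℝ, E) q, SmoothFieldAt A p ∧ A p = a ∧
      ∀ q, S.P q (A q) = A q := by
  obtain ⟨X, hX, rfl⟩ := exists_smoothFieldAt_eq a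
  refine ⟨fun q => (1 / 2 : ℝ) • (X q + S.field X q), (hX.add (hX.field S)).const_smul _, ?_, ?_⟩
  · simp only [AlmostProduct.field, ha]; module
  · intro q
    simp only [AlmostProduct.field, map_smul, map_add, S.sq]
    rw [add_comm]

theorem exists_smooth_antifixed (S : AlmostProduct E M) {ξ : TangentSpace 𝓘(ℝ, E) p}
    (hξ : S.P p ξ = -ξ) :
    ∃ A : ∀ q : M, TangentSpace 𝓘(ℝ, E) q, SmoothFieldAt A p ∧ A p = ξ ∧
      ∀ q, S.P q (A q) = -A q := by
  obtain ⟨X, hX, rfl⟩ := exists_smoothFieldAt_eq ξ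
  refine ⟨fun q => (1 / 2 : ℝ) • (X q - S.field X q), (hX.sub (hX.field S)).const_smul _, ?_, ?_⟩
  · simp only [AlmostProduct.field, hξ]; module
  · intro q
    simp only [AlmostProduct.field, map_smul, map_sub, S.sq]
    module

theorem SmoothFieldAt.inv_norm_sq (hX : SmoothFieldAt X p) (h0 : X p ≠ 0) :
    ContMDiffAt 𝓘(ℝ, E) 𝓘(ℝ, ℝ) ∞ (fun q => (‖X q‖ ^ 2)⁻¹) p := by
  have h := hX.inner hX
  simp only [real_inner_self_eq_norm_sq] at h
  have h1 : ContDiffAt ℝ ∞ (fun t : ℝ => t⁻¹) (‖X p‖ ^ 2) := contDiffAt_inv ℝ (by simpa using h0)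
  exact ContMDiffAt.comp p h1.contMDiffAt h

theorem SmoothFieldAt.eventually_ne_zero (hX : SmoothFieldAt X p) (h0 : X p ≠ 0) :
    ∀ᶠ q in nhds p, X q ≠ 0 := by
  have h := (hX.inner hX).continuousAt
  have h1 : ⟪X p, X p⟫_ℝ ≠ 0 := by simpa using h0
  filter_upwards [h.eventually_ne h1] with q hq
  simpa using hq

/-- The orthonormal bases defining `Omega` are chosen point by point, so smoothness is not visible
from the definition. Near `p`, both eigenparts of $\Omega$ are expressed through $(\nabla_A P)A$ and
$(\nabla_B P)B$ for smooth nonvanishing eigenfields $A$, $B$. -/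
theorem smoothFieldAt_Omega (hLC : IsLeviCivita nab) (hW1 : IsW1 n nab S) (hn : 1 ≤ n)
    (hdim : finrank ℝ E = 2 * n) (p : M) : SmoothFieldAt (Omega nab S) p := by
  obtain ⟨a, ha0, ha⟩ := S.exists_fixed hn hdim p
  obtain ⟨ξ, hξ0, hξ⟩ := S.exists_antifixed hn hdim p
  obtain ⟨A, hA, rfl, hPA⟩ := exists_smooth_fixed S ha
  obtain ⟨B, hB, rfl, hPB⟩ := exists_smooth_antifixed S hξ
  refine (((hLC.smoothFieldAt_nablaP (S := S) hA hA).smul (hA.inv_norm_sq ha0)).add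
    ((hLC.smoothFieldAt_nablaP (S := S) hB hB).smul (hB.inv_norm_sq hξ0))
      |>.const_smul (n : ℝ)).congr ?_
  filter_upwards [hA.eventually_ne_zero ha0, hB.eventually_ne_zero hξ0] with q hAq hBq
  have h1 := congr((‖A q‖ ^ 2)⁻¹ • $(hW1.nablaP_fixed hn (hPA q)))
  have h2 := congr((‖B q‖ ^ 2)⁻¹ • $(hW1.nablaP_antifixed hn (hPB q)))
  rw [inv_smul_smul₀ (by simpa using hAq)] at h1
  rw [inv_smul_smul₀ (by simpa using hBq)] at h2
  have h3 := congr((1 / 2 : ℝ) • ($h1 + $h2))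
  have h4 : (1 / 2 : ℝ) • (Omega nab S q - (S.P q) (Omega nab S q) + (Omega nab S q
    + (S.P q) (Omega nab S q))) = Omega nab S q := by module
  rw [h4] at h3
  rw [← h3]
  module

end Omega

/-! ### Functions with zero differential on a connected manifold -/

section Constant

variable {E : Type*} [NormedAddCommGroup E] [NormedSpace ℝ E]
  {M : Type*} [TopologicalSpace M] [ChartedSpace E M] [IsManifold 𝓘(ℝ, E) ∞ M]

theorem eq_of_mvfderiv_eq_zero [PreconnectedSpace M] {f : M → ℝ}
    (hf : ∀ p, MDifferentiableAt 𝓘(ℝ, E) 𝓘(ℝ, ℝ) f p) (h : ∀ p, d% f p = 0) (p q : M) :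
    f p = f q := by
  refine IsLocallyConstant.apply_eq_of_preconnectedSpace
    ((IsLocallyConstant.iff_eventually_eq f).2 fun p => ?_) p q
  set φ := extChartAt 𝓘(ℝ, E) p with hφ
  have hopen : IsOpen φ.target := isOpen_extChartAt_target p
  obtain ⟨r, hr, hball⟩ := Metric.isOpen_iff.1 hopen (φ p) (mem_extChartAt_target p)
  have hg : ∀ y ∈ Metric.ball (φ p) r, HasFDerivAt (f ∘ φ.symm) (0 : E →L[ℝ] ℝ) y := by
    intro y hy
    have h1 : MDifferentiableAt 𝓘(ℝ, E) 𝓘(ℝ, E) φ.symm y :=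
      ((contMDiffOn_extChartAt_symm (n := 1) p).contMDiffAt
        (hopen.mem_nhds (hball hy))).mdifferentiableAt (by simp)
    have h2 : HasMFDerivAt 𝓘(ℝ, E) 𝓘(ℝ, ℝ) f (φ.symm y) 0 := by
      have := (hf (φ.symm y)).hasMFDerivAt
      have h0 : mfderiv 𝓘(ℝ, E) 𝓘(ℝ, ℝ) f (φ.symm y) = 0 := h (φ.symm y)
      rwa [h0] at this
    have h3 := h2.comp y h1.hasMFDerivAt
    rw [ContinuousLinearMap.zero_comp] at h3
    exact h3.hasFDerivAt
  have hconst : ∀ y ∈ Metric.ball (φ p) r, (f ∘ φ.symm) y = (f ∘ φ.symm) (φ p) := by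
    intro y hy
    refine Metric.isOpen_ball.is_const_of_fderiv_eq_zero (𝕜 := ℝ)
      (convex_ball _ _).isPreconnected
      (fun z hz => (hg z hz).differentiableAt.differentiableWithinAt)
      (fun z hz => (hg z hz).fderiv) hy (Metric.mem_ball_self hr)
  filter_upwards [(continuousAt_extChartAt (I := 𝓘(ℝ, E)) p).preimage_mem_nhds
    (Metric.ball_mem_nhds _ hr), extChartAt_source_mem_nhds (I := 𝓘(ℝ, E)) p] with q hq hqs
  have := hconst (φ q) hq
  simpa [φ.left_inv hqs, φ.left_inv (mem_extChartAt_source p)] using this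

end Constant

set_option linter.unusedSectionVars false

variable {E : Type*} [NormedAddCommGroup E] [NormedSpace ℝ E] [FiniteDimensional ℝ E]
  {M : Type*} [TopologicalSpace M] [ChartedSpace E M] [IsManifold 𝓘(ℝ, E) ∞ M]

/-! ### First Bianchi identity for parallel torsion -/

section Bianchi

variable {nab' : LinearConnection E M} {X Y Z : ∀ q : M, TangentSpace 𝓘(ℝ, E) q} {p : M}

theorem connection_sub (nab' : LinearConnection E M) (hX : MDiffAt (T% X) p)
    (hY : MDiffAt (T% Y) p) :
    nab' (fun q => X q - Y q) p = nab' X p - nab' Y p := by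
  have e : (fun q => X q - Y q) = X + (-1 : ℝ) • Y := by
    funext q; simp [sub_eq_add_neg]
  have hY' : MDiffAt (T% ((-1 : ℝ) • Y)) p :=
    MDifferentiableAt.smul_section (mdifferentiableAt_const (c := (-1 : ℝ))) hY
  rw [e, nab'.isCovariantDerivativeOnUniv.add hX hY',
    nab'.isCovariantDerivativeOnUniv.smul_const (-1 : ℝ) hY]
  simp [sub_eq_add_neg]

theorem mlieBracket_cyclic (hX : SmoothFieldAt X p) (hY : SmoothFieldAt Y p)
    (hZ : SmoothFieldAt Z p) :
    VectorField.mlieBracket 𝓘(ℝ, E) X (VectorField.mlieBracket 𝓘(ℝ, E) Y Z) p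
      + VectorField.mlieBracket 𝓘(ℝ, E) Y (VectorField.mlieBracket 𝓘(ℝ, E) Z X) p
      + VectorField.mlieBracket 𝓘(ℝ, E) Z (VectorField.mlieBracket 𝓘(ℝ, E) X Y) p = 0 := by
  have : IsManifold 𝓘(ℝ, E) (minSmoothness ℝ 3) M := by
    rw [minSmoothness_of_isRCLikeNormedField]; infer_instance
  have hle : minSmoothness ℝ 2 ≤ ∞ := by
    rw [minSmoothness_of_isRCLikeNormedField]; norm_cast
  have h := VectorField.leibniz_identity_mlieBracket_apply (hX.of_le hle) (hY.of_le hle)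
    (hZ.of_le hle)
  have h1 : VectorField.mlieBracket 𝓘(ℝ, E) Z X
      = (-1 : ℝ) • VectorField.mlieBracket 𝓘(ℝ, E) X Z := by
    rw [VectorField.mlieBracket_swap]; simp
  rw [h, h1, VectorField.mlieBracket_const_smul_right (hX.mlieBracket hZ).mdifferentiableAt,
    VectorField.mlieBracket_swap_apply (V := VectorField.mlieBracket 𝓘(ℝ, E) X Y)]
  module

theorem SmoothFieldAt.torsion
    (hsm : ∀ {X Y : ∀ q : M, TangentSpace 𝓘(ℝ, E) q}, SmoothFieldAt X p → SmoothFieldAt Y p →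
      SmoothFieldAt (fun q => nab' Y q (X q)) p)
    (hX : SmoothFieldAt X p) (hY : SmoothFieldAt Y p) :
    SmoothFieldAt (fun q => nab'.torsion q (X q) (Y q)) p := by
  refine (((hsm hX hY).sub (hsm hY hX)).sub (hX.mlieBracket hY)).congr ?_
  filter_upwards [hX.eventually_mdifferentiableAt, hY.eventually_mdifferentiableAt] with q hXq hYq
  exact nab'.torsion_apply hXq hYq

/-- Differentiate $T'(Y,Z) = \nabla'_Y Z - \nabla'_Z Y - [Y,Z]$ along $X$, then trade
$\nabla'_X[Y,Z]$ for $\nabla'_{[Y,Z]}X + T'(X,[Y,Z]) + [X,[Y,Z]]$. The left side is arranged so that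
its cyclic sum is that of the curvature. -/
theorem HasParallelTorsion.second_derivative
    (hsm : ∀ {X Y : ∀ q : M, TangentSpace 𝓘(ℝ, E) q}, SmoothFieldAt X p → SmoothFieldAt Y p →
      SmoothFieldAt (fun q => nab' Y q (X q)) p)
    (htor : HasParallelTorsion nab') (hX : SmoothFieldAt X p) (hY : SmoothFieldAt Y p)
    (hZ : SmoothFieldAt Z p) :
    nab' (fun q => nab' Z q (Y q)) p (X p) - nab' (fun q => nab' Y q (Z q)) p (X p)
      - nab' X p (VectorField.mlieBracket 𝓘(ℝ, E) Y Z p)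
      = nab'.torsion p (nab' Y p (X p)) (Z p) + nab'.torsion p (Y p) (nab' Z p (X p))
        + nab'.torsion p (X p) (nab' Z p (Y p)) - nab'.torsion p (X p) (nab' Y p (Z p))
        - nab'.torsion p (X p) (nab'.torsion p (Y p) (Z p))
        + VectorField.mlieBracket 𝓘(ℝ, E) X (VectorField.mlieBracket 𝓘(ℝ, E) Y Z) p := by
  have h1 := htor p Y Z hY hZ (X p)
  have hYZ := hY.mlieBracket hZ
  have hD := (hsm hY hZ).sub (hsm hZ hY)
  have h2 : nab' (fun q => nab'.torsion q (Y q) (Z q)) p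
      = nab' (fun q => nab' Z q (Y q)) p - nab' (fun q => nab' Y q (Z q)) p
        - nab' (VectorField.mlieBracket 𝓘(ℝ, E) Y Z) p := by
    rw [← connection_sub nab' (hsm hY hZ).mdifferentiableAt (hsm hZ hY).mdifferentiableAt,
      ← connection_sub nab' hD.mdifferentiableAt hYZ.mdifferentiableAt]
    refine IsCovariantDerivativeOn.congr_of_eventuallyEq nab'.isCovariantDerivativeOnUniv
      (hY.torsion hsm hZ).mdifferentiableAt (hD.sub hYZ).mdifferentiableAt Filter.univ_mem ?_
    filter_upwards [hY.eventually_mdifferentiableAt, hZ.eventually_mdifferentiableAt]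
      with q hYq hZq
    exact nab'.torsion_apply hYq hZq
  rw [h2] at h1
  have h3 := nab'.torsion_apply hX.mdifferentiableAt hYZ.mdifferentiableAt
  have h4 := nab'.torsion_apply hY.mdifferentiableAt hZ.mdifferentiableAt
  rw [show VectorField.mlieBracket 𝓘(ℝ, E) Y Z p = nab' Z p (Y p) - nab' Y p (Z p)
    - nab'.torsion p (Y p) (Z p) by rw [h4]; abel] at h3 ⊢
  simp only [map_sub, sub_apply] at h1 h3 ⊢
  rw [← sub_eq_zero] at h3 ⊢
  refine Eq.trans ?_ (congr($h1 - $h3).trans (sub_zero 0))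
  abel

/-- The algebraic Bianchi identity for a connection with parallel torsion. -/
theorem HasParallelTorsion.cyclic_torsion
    (hsm : ∀ {X Y : ∀ q : M, TangentSpace 𝓘(ℝ, E) q}, SmoothFieldAt X p → SmoothFieldAt Y p →
      SmoothFieldAt (fun q => nab' Y q (X q)) p)
    (htor : HasParallelTorsion nab') (hX : SmoothFieldAt X p) (hY : SmoothFieldAt Y p)
    (hZ : SmoothFieldAt Z p) :
    curvature nab' X Y Z p + curvature nab' Y Z X p + curvature nab' Z X Y p
      = -(nab'.torsion p (X p) (nab'.torsion p (Y p) (Z p))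
        + nab'.torsion p (Y p) (nab'.torsion p (Z p) (X p))
        + nab'.torsion p (Z p) (nab'.torsion p (X p) (Y p))) := by
  have h1 := htor.second_derivative hsm hX hY hZ
  have h2 := htor.second_derivative hsm hY hZ hX
  have h3 := htor.second_derivative hsm hZ hX hY
  have hJ := mlieBracket_cyclic hX hY hZ
  -- With the arguments swapped, every torsion term containing a first derivative cancels in the
  -- cyclic sum; the double brackets cancel by Jacobi.
  rw [nab'.torsion_antisymm (nab' Y p (X p)) (Z p)] at h1
  rw [nab'.torsion_antisymm (nab' Z p (Y p)) (X p)] at h2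
  rw [nab'.torsion_antisymm (nab' X p (Z p)) (Y p)] at h3
  have h := congr($h1 + $h2 + $h3 + $hJ)
  rw [← sub_eq_zero] at h ⊢
  refine Eq.trans ?_ h
  unfold curvature
  abel

end Bianchi

/-! ### Torsion of the family and parallelism of `Omega` -/

variable [RiemannianBundle (fun x : M => TangentSpace 𝓘(ℝ, E) x)]
  [IsContMDiffRiemannianBundle 𝓘(ℝ, E) ∞ E (fun x : M => TangentSpace 𝓘(ℝ, E) x)]
  {S : AlmostProduct E M} {n : ℕ} {p : M} {nab nab' : LinearConnection E M} {lam mu : ℝ}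
  {X Y Z : ∀ q : M, TangentSpace 𝓘(ℝ, E) q}

theorem HasParameters.torsion_apply (h : HasParameters n nab nab' S lam mu)
    (hLC : IsLeviCivita nab) (x y : TangentSpace 𝓘(ℝ, E) p) :
    nab'.torsion p x y
      = (lam * theta nab S p (S.P p x) + mu * theta nab S p x) • S.P p y
        - (lam * theta nab S p (S.P p y) + mu * theta nab S p y) • S.P p x
        + (lam * theta nab S p x + (mu + 1 / (2 * (n : ℝ))) * theta nab S p (S.P p x)) • y
        - (lam * theta nab S p y + (mu + 1 / (2 * (n : ℝ))) * theta nab S p (S.P p y)) • x := by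
  obtain ⟨X, hX, rfl⟩ := exists_smoothFieldAt_eq x
  obtain ⟨Y, hY, rfl⟩ := exists_smoothFieldAt_eq y
  have h0 := (CovariantDerivative.torsion_eq_zero_iff _).1 hLC.2 hX.mdifferentiableAt
    hY.mdifferentiableAt
  rw [nab'.torsion_apply hX.mdifferentiableAt hY.mdifferentiableAt, ← h0,
    h p Y hY.mdifferentiableAt, h p X hX.mdifferentiableAt, ← S.inner_P_left,
    real_inner_comm (Y p) (S.P p (X p)), real_inner_comm (Y p) (X p)]
  module

theorem HasParameters.smoothFieldAt (h : HasParameters n nab nab' S lam mu)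
    (hLC : IsLeviCivita nab) (hΩ : SmoothFieldAt (Omega nab S) p)
    (hX : SmoothFieldAt X p) (hY : SmoothFieldAt Y p) :
    SmoothFieldAt (fun q => nab' Y q (X q)) p := by
  have hPY := hY.field S
  have hPΩ := hΩ.field S
  have c : ∀ r : ℝ, ContMDiffAt 𝓘(ℝ, E) 𝓘(ℝ, ℝ) ∞ (fun _ : M => r) p :=
    fun r => contMDiffAt_const
  refine (((((hLC.smoothFieldAt hX hY).add
    (((hPΩ.const_smul lam).add (hΩ.const_smul mu)).smul (hX.inner hPY))).sub
    ((hX.field S).smul (((c lam).mul (hΩ.inner hPY)).add ((c mu).mul (hΩ.inner hY))))).add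
    (((hΩ.const_smul lam).add (hPΩ.const_smul (mu + 1 / (2 * (n : ℝ))))).smul (hX.inner hY))).sub
    (hX.smul (((c lam).mul (hΩ.inner hY)).add
      ((c (mu + 1 / (2 * (n : ℝ)))).mul (hΩ.inner hPY))))).congr ?_
  filter_upwards [hY.eventually_mdifferentiableAt] with q hq
  rw [h q Y hq (X q)]
  simp only [theta_eq_inner]
  rfl

theorem IsNatural.apply_field (hnat : IsNatural nab' S) (hY : MDiffAt (T% Y) p)
    (x : TangentSpace 𝓘(ℝ, E) p) : nab' (S.field Y) p x = S.P p (nab' Y p x) := by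
  have h := nablaP_apply nab' S hY x
  rw [hnat.2] at h
  exact (sub_eq_zero.1 h.symm)

/-- The opposite signs of $P$ on `a` and `ξ` cancel $\lambda$ and $\mu$, so the mixed torsion
determines $\Omega$ whatever the parameters. -/
theorem HasParameters.torsion_fixed_antifixed (h : HasParameters n nab nab' S lam mu)
    (hLC : IsLeviCivita nab) {a ξ : TangentSpace 𝓘(ℝ, E) p} (ha : S.P p a = a)
    (hξ : S.P p ξ = -ξ) :
    nab'.torsion p a ξ
      = (1 / (2 * (n : ℝ))) • (⟪Omega nab S p, a⟫_ℝ • ξ + ⟪Omega nab S p, ξ⟫_ℝ • a) := by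
  rw [h.torsion_apply hLC, ha, hξ]
  simp only [theta_eq_inner, inner_neg_right]
  module

/-- As $\nabla'P = 0$, derivatives of eigenfields $A$, $B$ remain in their eigenbundles.
Differentiating the mixed torsion, the terms with $\nabla'A$ and $\nabla'B$ match the corrections in
$\nabla'T'$; only those with $\nabla'\Omega$ survive. -/
theorem HasParameters.inner_nabla_Omega (h : HasParameters n nab nab' S lam mu)
    (hLC : IsLeviCivita nab) (hnat : IsNatural nab' S) (htor : HasParallelTorsion nab')
    (hn : 1 ≤ n) (hΩ : SmoothFieldAt (Omega nab S) p) {a ξ : TangentSpace 𝓘(ℝ, E) p}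
    (ha : S.P p a = a) (hξ : S.P p ξ = -ξ) (x : TangentSpace 𝓘(ℝ, E) p) :
    ⟪nab' (Omega nab S) p x, a⟫_ℝ • ξ + ⟪nab' (Omega nab S) p x, ξ⟫_ℝ • a = 0 := by
  obtain ⟨A, hA, rfl, hPA⟩ := exists_smooth_fixed S ha
  obtain ⟨B, hB, rfl, hPB⟩ := exists_smooth_antifixed S hξ
  obtain ⟨X, -, rfl⟩ := exists_smoothFieldAt_eq x
  have hdA : S.P p (nab' A p (X p)) = nab' A p (X p) := by
    rw [← hnat.apply_field hA.mdifferentiableAt]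
    congr 3
    funext q; exact hPA q
  have hdB : S.P p (nab' B p (X p)) = - nab' B p (X p) := by
    rw [← hnat.apply_field hB.mdifferentiableAt]
    have e : S.field B = (-1 : ℝ) • B := by
      funext q; simp [AlmostProduct.field, hPB q]
    rw [e, nab'.isCovariantDerivativeOnUniv.smul_const _ hB.mdifferentiableAt]
    simp
  have h1 := htor p A B hA hB (X p)
  have hfA := hΩ.inner hA
  have hfB := hΩ.inner hB
  have e : (fun q => nab'.torsion q (A q) (B q)) = (1 / (2 * (n : ℝ))) •
      ((fun q => ⟪Omega nab S q, A q⟫_ℝ) • B + (fun q => ⟪Omega nab S q, B q⟫_ℝ) • A) := by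
    funext q
    exact h.torsion_fixed_antifixed hLC (hPA q) (hPB q)
  have h2 : SmoothFieldAt ((fun q => ⟪Omega nab S q, A q⟫_ℝ) • B) p := hB.smul hfA
  have h3 : SmoothFieldAt ((fun q => ⟪Omega nab S q, B q⟫_ℝ) • A) p := hA.smul hfB
  have h4 : SmoothFieldAt ((fun q => ⟪Omega nab S q, A q⟫_ℝ) • B +
    (fun q => ⟪Omega nab S q, B q⟫_ℝ) • A) p := h2.add h3
  rw [e, nab'.isCovariantDerivativeOnUniv.smul_const _ h4.mdifferentiableAt,
    nab'.isCovariantDerivativeOnUniv.add h2.mdifferentiableAt h3.mdifferentiableAt,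
    nab'.isCovariantDerivativeOnUniv.leibniz hB.mdifferentiableAt
      (hfA.mdifferentiableAt (by simp)),
    nab'.isCovariantDerivativeOnUniv.leibniz hA.mdifferentiableAt
      (hfB.mdifferentiableAt (by simp)),
    h.torsion_fixed_antifixed hLC hdA (hPB p), h.torsion_fixed_antifixed hLC (hPA p) hdB] at h1
  simp only [smul_apply, add_apply,
    ContinuousLinearMap.smulRight_apply,
    hnat.1.mvfderiv_inner_eq X hΩ.mdifferentiableAt hA.mdifferentiableAt,
    hnat.1.mvfderiv_inner_eq X hΩ.mdifferentiableAt hB.mdifferentiableAt] at h1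
  have hc : (1 / (2 * (n : ℝ))) ≠ 0 := by positivity
  refine (smul_eq_zero.1 (Eq.trans ?_ h1)).resolve_left hc
  module

theorem HasParameters.nabla_Omega (h : HasParameters n nab nab' S lam mu)
    (hLC : IsLeviCivita nab) (hnat : IsNatural nab' S) (htor : HasParallelTorsion nab')
    (hn : 1 ≤ n) (hdim : finrank ℝ E = 2 * n) (hΩ : SmoothFieldAt (Omega nab S) p) :
    nab' (Omega nab S) p = 0 := by
  ext x
  obtain ⟨a, ha0, ha⟩ := S.exists_fixed hn hdim p
  obtain ⟨ξ, hξ0, hξ⟩ := S.exists_antifixed hn hdim p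
  have hfix : ∀ b, S.P p b = b → ⟪nab' (Omega nab S) p x, b⟫_ℝ = 0 := by
    intro b hb
    have h1 := h.inner_nabla_Omega hLC hnat htor hn hΩ hb hξ x
    have h2 := congr(⟪$h1, ξ⟫_ℝ)
    -- Orthogonality of the eigenspaces removes the `b` term, leaving a multiple of $\|\xi\|^2 \ne
    -- 0$.
    simpa [inner_add_left, inner_smul_left, S.inner_eq_zero hb hξ, hξ0] using h2
  have hanti : ∀ b, S.P p b = -b → ⟪nab' (Omega nab S) p x, b⟫_ℝ = 0 := by
    intro b hb
    have h1 := h.inner_nabla_Omega hLC hnat htor hn hΩ ha hb x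
    have h2 := congr(⟪a, $h1⟫_ℝ)
    simpa [inner_add_right, inner_smul_right, S.inner_eq_zero ha hb, ha0] using h2
  refine ext_inner_right ℝ fun v => ?_
  have h1 := hfix (v + S.P p v) (by rw [map_add, S.sq, add_comm])
  have h2 := hanti (v - S.P p v) (by rw [map_sub, S.sq, neg_sub])
  rw [inner_add_right] at h1
  rw [inner_sub_right] at h2
  rw [zero_apply, inner_zero_left]
  linarith

set_option linter.unusedSectionVars false

variable {E : Type*} [NormedAddCommGroup E] [NormedSpace ℝ E] [FiniteDimensional ℝ E]
  {M : Type*} [TopologicalSpace M] [ChartedSpace E M] [IsManifold 𝓘(ℝ, E) ∞ M]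
  [RiemannianBundle (fun x : M => TangentSpace 𝓘(ℝ, E) x)]
  [IsContMDiffRiemannianBundle 𝓘(ℝ, E) ∞ E (fun x : M => TangentSpace 𝓘(ℝ, E) x)]
  {S : AlmostProduct E M} {n : ℕ} {nab nab' : LinearConnection E M} {lam mu : ℝ}

/-! ### The Naveira classes as eigenvector conditions on `Omega` -/

section Classes

theorem isW6bar_of_fixed (hW1 : IsW1 n nab S)
    (h : ∀ p, S.P p (Omega nab S p) = Omega nab S p) : IsW6bar n nab S := by
  intro p a b ξ η ha hb hξ hη
  have h1 : ∀ ζ, S.P p ζ = -ζ → ⟪Omega nab S p, ζ⟫_ℝ = 0 := fun ζ hζ => S.inner_eq_zero (h p) hζ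
  have e := S.inner_eq_zero ha hξ
  have e' := (real_inner_comm a ξ).trans e
  constructor
  · simp only [hW1 p, thetaH, theta_eq_inner, ha, hη, h1 η hη, inner_neg_right, e']
    ring
  · simp only [hW1 p, theta_eq_inner, hb, hξ, h1 ξ hξ, inner_neg_right, e]
    ring

theorem isW3bar_of_antifixed (hW1 : IsW1 n nab S)
    (h : ∀ p, S.P p (Omega nab S p) = -Omega nab S p) : IsW3bar n nab S := by
  intro p a b ξ η ha hb hξ hη
  have h1 : ∀ c, S.P p c = c → ⟪Omega nab S p, c⟫_ℝ = 0 := fun c hc => by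
    rw [real_inner_comm]; exact S.inner_eq_zero hc (h p)
  have e := S.inner_eq_zero ha hξ
  have e' := (real_inner_comm a ξ).trans e
  constructor
  · simp only [hW1 p, thetaV, theta_eq_inner, hb, hξ, h1 b hb, inner_neg_right, e]
    ring
  · simp only [hW1 p, theta_eq_inner, ha, hη, h1 a ha, inner_neg_right, e']
    ring

/-- In $\mathcal W_1$, $F(a,a,\xi) = \frac1n\|a\|^2\theta(\xi)$; its vanishing for one $a \ne 0$
makes $\Omega$ orthogonal to the $(-1)$-eigenspace. -/
theorem IsW6bar.P_Omega (hW6 : IsW6bar n nab S) (hW1 : IsW1 n nab S) (hn : 1 ≤ n)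
    (hdim : finrank ℝ E = 2 * n) (p : M) : S.P p (Omega nab S p) = Omega nab S p := by
  obtain ⟨a, ha0, ha⟩ := S.exists_fixed hn hdim p
  have hn' : (n : ℝ) ≠ 0 := by positivity
  have h1 : ∀ ξ, S.P p ξ = -ξ → ⟪Omega nab S p, ξ⟫_ℝ = 0 := by
    intro ξ hξ
    have h := (hW6 p a a ξ ξ ha ha hξ hξ).2
    rw [hW1, hξ, ha, theta_eq_inner, theta_eq_inner, inner_neg_right, inner_neg_right,
      S.inner_eq_zero ha hξ] at h
    have h' : 1 / (n : ℝ) * (⟪a, a⟫_ℝ * ⟪Omega nab S p, ξ⟫_ℝ) = 0 := by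
      rw [← h]; field_simp; ring
    simpa [hn', ha0] using h'
  refine ext_inner_right ℝ fun v => ?_
  have := h1 (v - S.P p v) (by rw [map_sub, S.sq, neg_sub])
  rw [inner_sub_right] at this
  rw [S.inner_P_left]
  linarith

theorem IsW3bar.P_Omega (hW3 : IsW3bar n nab S) (hW1 : IsW1 n nab S) (hn : 1 ≤ n)
    (hdim : finrank ℝ E = 2 * n) (p : M) : S.P p (Omega nab S p) = -Omega nab S p := by
  obtain ⟨ξ, hξ0, hξ⟩ := S.exists_antifixed hn hdim p
  have hn' : (n : ℝ) ≠ 0 := by positivity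
  have h1 : ∀ a, S.P p a = a → ⟪Omega nab S p, a⟫_ℝ = 0 := by
    intro a ha
    have h := (hW3 p a a ξ ξ ha ha hξ hξ).2
    rw [hW1, hξ, ha, theta_eq_inner, inner_neg_right, real_inner_comm a ξ,
      S.inner_eq_zero ha hξ] at h
    have h' : 1 / (n : ℝ) * (⟪ξ, ξ⟫_ℝ * ⟪Omega nab S p, a⟫_ℝ) = 0 := by
      rw [← h]; field_simp; ring
    simpa [hn', hξ0] using h'
  refine ext_inner_right ℝ fun v => ?_
  have := h1 (v + S.P p v) (by rw [map_add, S.sq, add_comm])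
  rw [inner_add_right] at this
  rw [S.inner_P_left, inner_neg_left]
  linarith

theorem wVanishes_of_P_Omega {ε : ℝ} (h : ∀ p, S.P p (Omega nab S p) = ε • Omega nab S p) :
    WVanishes nab S := by
  intro p y z
  simp only [tensorW, theta_eq_inner, ← S.inner_P_left, h, inner_smul_left]
  simp
  ring

end Classes

/-! ### Coincidences within the family -/

section Parameters

theorem HasParameters.zero_of_dim_two (h : HasParameters 1 nab nab' S lam mu)
    (hdim : finrank ℝ E = 2) : HasParameters 1 nab nab' S 0 0 := by
  intro p Y hY x
  rw [h p Y hY x]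
  have h1 := S.inner_smul_cancel hdim (Omega nab S p) x (Y p)
  have h2 := S.inner_smul_cancel hdim (S.P p (Omega nab S p)) x (Y p)
  rw [S.sq, S.inner_P_left, S.isometry] at h2
  simp only [theta_eq_inner]
  rw [← sub_eq_zero]
  refine Eq.trans ?_ (congr(mu • $h1 + lam • $h2).trans (by simp))
  module

/-- Since $\Omega = \varepsilon P\Omega$, each $\lambda$ term is $\varepsilon\lambda$ times the
matching $\mu$ term, so only $\varepsilon\lambda + \mu$ matters. -/
theorem HasParameters.of_P_Omega (h : HasParameters n nab nab' S lam mu) {ε : ℝ} (hε : ε * ε = 1)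
    (hP : ∀ p, S.P p (Omega nab S p) = ε • Omega nab S p) :
    HasParameters n nab nab' S 0 (ε * lam + mu) := by
  intro p Y hY x
  have hθ : ⟪Omega nab S p, S.P p (Y p)⟫_ℝ = ε * ⟪Omega nab S p, Y p⟫_ℝ := by
    rw [← S.inner_P_left, hP, inner_smul_left]; rfl
  rw [h p Y hY x]
  simp only [theta_eq_inner, hθ, hP]
  have h1 : lam • Omega nab S p = (ε * lam) • ε • Omega nab S p := by
    rw [smul_smul, mul_right_comm, hε, one_mul]
  have h2 : lam * ⟪Omega nab S p, Y p⟫_ℝ = (ε * lam) * (ε * ⟪Omega nab S p, Y p⟫_ℝ) := by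
    linear_combination (-lam * ⟪Omega nab S p, Y p⟫_ℝ) * hε
  rw [h1, h2]
  module

end Parameters

/-! ### Parallel `Omega` with vanishing `W` -/

section ParallelOmega

variable [PreconnectedSpace M]

theorem inner_eq_of_parallel (hm : nab'.IsMetricCompatible
      (V := fun x : M => TangentSpace 𝓘(ℝ, E) x))
    {X Y : ∀ q : M, TangentSpace 𝓘(ℝ, E) q} (hX : ∀ p, SmoothFieldAt X p)
    (hY : ∀ p, SmoothFieldAt Y p) (hX0 : ∀ p, nab' X p = 0) (hY0 : ∀ p, nab' Y p = 0) (p q : M) :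
    ⟪X p, Y p⟫_ℝ = ⟪X q, Y q⟫_ℝ := by
  refine eq_of_mvfderiv_eq_zero (E := E) (f := fun p => ⟪X p, Y p⟫_ℝ)
    (fun p => ((hX p).inner (hY p)).mdifferentiableAt (by simp)) (fun p => ?_) p q
  ext v
  obtain ⟨Z, -, rfl⟩ := exists_smoothFieldAt_eq v
  rw [hm.mvfderiv_inner_eq Z (hX p).mdifferentiableAt (hY p).mdifferentiableAt]
  simp [hX0, hY0]

/-- On a connected manifold with parallel `Ω`, the vanishing of `W` forces `Ω` to be an
eigenvector field of `P`. -/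
theorem P_Omega_of_wVanishes (hnat : IsNatural nab' S) (hW : WVanishes nab S)
    (hΩ : ∀ p, SmoothFieldAt (Omega nab S) p) (hpar : ∀ p, nab' (Omega nab S) p = 0) :
    (∀ p, S.P p (Omega nab S p) = Omega nab S p) ∨
      (∀ p, S.P p (Omega nab S p) = -Omega nab S p) := by
  have hparP : ∀ p, nab' (S.field (Omega nab S)) p = 0 := fun p => by
    ext x
    rw [hnat.apply_field (hΩ p).mdifferentiableAt, hpar]
    simp
  have hc := inner_eq_of_parallel hnat.1 hΩ hΩ hpar hpar
  have hd := inner_eq_of_parallel hnat.1 (fun p => (hΩ p).field S) hΩ hparP hpar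
  have key : ∀ p, ⟪S.P p (Omega nab S p), Omega nab S p⟫_ℝ • Omega nab S p
      = ⟪Omega nab S p, Omega nab S p⟫_ℝ • S.P p (Omega nab S p) := by
    intro p
    refine ext_inner_right ℝ fun z => ?_
    have h := hW p (Omega nab S p) z
    simp only [tensorW, theta_eq_inner, ← S.inner_P_left] at h
    rw [inner_smul_left, inner_smul_left]
    exact sub_eq_zero.1 h
  by_cases h0 : ∀ p, Omega nab S p = 0
  · exact Or.inl fun p => by rw [h0, map_zero]
  push Not at h0
  obtain ⟨p₀, hp₀⟩ := h0
  have hcne : ∀ p, ⟪Omega nab S p, Omega nab S p⟫_ℝ ≠ 0 := fun p => by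
    rw [hc p p₀]; simpa using hp₀
  -- Pairing `key` with $P\Omega$ fixes $g(P\Omega,\Omega)$ up to sign at `p₀`; constancy of both
  -- inner products carries that sign to every point.
  have hsq : ⟪S.P p₀ (Omega nab S p₀), Omega nab S p₀⟫_ℝ ^ 2
      = ⟪Omega nab S p₀, Omega nab S p₀⟫_ℝ ^ 2 := by
    have h := congr(⟪$(key p₀), S.P p₀ (Omega nab S p₀)⟫_ℝ)
    rw [inner_smul_left, inner_smul_left, S.isometry, ← S.inner_P_left] at h
    rw [sq, sq]
    exact h
  rcases sq_eq_sq_iff_eq_or_eq_neg.1 hsq with h | h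
  · refine Or.inl fun p => smul_right_injective _ (hcne p) ?_
    have hp : ⟪S.P p (Omega nab S p), Omega nab S p⟫_ℝ = ⟪Omega nab S p, Omega nab S p⟫_ℝ :=
      (hd p p₀).trans (h.trans (hc p₀ p))
    simpa only [hp] using (key p).symm
  · refine Or.inr fun p => smul_right_injective _ (hcne p) ?_
    have hp : ⟪S.P p (Omega nab S p), Omega nab S p⟫_ℝ = -⟪Omega nab S p, Omega nab S p⟫_ℝ :=
      (hd p p₀).trans (h.trans (congrArg Neg.neg (hc p₀ p)))
    have := (key p).symm
    rw [hp, neg_smul] at this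
    simpa only [smul_neg] using this

end ParallelOmega

/-! ### The parameters vanish when `W` does not -/

section Uniqueness

/-- Because $\lambda$ and $\mu$ are constants, it is enough to compute the cyclic torsion identity
at a single point where $W \ne 0$; there both eigenparts of $\Omega$ are nonzero. -/
theorem HasParameters.eq_zero_of_not_wVanishes (h : HasParameters n nab nab' S lam mu)
    (hLC : IsLeviCivita nab) (hW1 : IsW1 n nab S) (hn : 2 ≤ n) (hdim : finrank ℝ E = 2 * n)
    (htor : HasParallelTorsion nab') (hcurv : HasRiemannianPCurvature nab' S)
    (hW : ¬ WVanishes nab S) : lam = 0 ∧ mu = 0 := by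
  simp only [WVanishes, not_forall] at hW
  obtain ⟨p, y, z, hyz⟩ := hW
  have hΩ := smoothFieldAt_Omega hLC hW1 (by omega) hdim p
  set Ω := Omega nab S p with hΩdef
  have hcyc : ∀ u v w : TangentSpace 𝓘(ℝ, E) p,
      nab'.torsion p u (nab'.torsion p v w) + nab'.torsion p v (nab'.torsion p w u)
        + nab'.torsion p w (nab'.torsion p u v) = 0 := by
    intro u v w
    obtain ⟨U, hU, rfl⟩ := exists_smoothFieldAt_eq u
    obtain ⟨V, hV, rfl⟩ := exists_smoothFieldAt_eq v
    obtain ⟨W, hW, rfl⟩ := exists_smoothFieldAt_eq w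
    have h1 := htor.cyclic_torsion (h.smoothFieldAt hLC hΩ) hU hV hW
    rw [← neg_eq_zero, ← h1]
    refine ext_inner_right ℝ fun t => ?_
    obtain ⟨T, hT, rfl⟩ := exists_smoothFieldAt_eq t
    have h2 := (hcurv p U V W T hU hV hW hT).2.2.1
    simpa only [curvature4, ← inner_add_left, inner_zero_left] using h2
  have hn0 : (n : ℝ) ≠ 0 := by positivity
  set a := Ω + S.P p Ω with ha
  set ξ := Ω - S.P p Ω with hξ
  have hPa : S.P p a = a := by rw [ha, map_add, S.sq, add_comm]
  have hPξ : S.P p ξ = -ξ := by rw [hξ, map_sub, S.sq, neg_sub]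
  have haΩ : ∀ b, S.P p b = b → ⟪Ω, b⟫_ℝ = (1 / 2) * ⟪a, b⟫_ℝ := by
    intro b hb
    rw [ha, inner_add_left, S.inner_P_left, hb]; ring
  have hξΩ : ∀ b, S.P p b = -b → ⟪Ω, b⟫_ℝ = (1 / 2) * ⟪ξ, b⟫_ℝ := by
    intro b hb
    rw [hξ, inner_sub_left, S.inner_P_left, hb, inner_neg_right]; ring
  have ha0 : a ≠ 0 := by
    intro h0
    apply hyz
    have : S.P p Ω = -Ω := (neg_eq_of_add_eq_zero_right h0).symm
    simp only [tensorW, theta_eq_inner, ← S.inner_P_left, ← hΩdef, this, inner_neg_left]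
    ring
  have hξ0 : ξ ≠ 0 := by
    intro h0
    apply hyz
    have : S.P p Ω = Ω := (sub_eq_zero.1 h0).symm
    simp only [tensorW, theta_eq_inner, ← S.inner_P_left, ← hΩdef, this]
    ring
  have haa : ⟪a, a⟫_ℝ ≠ 0 := by simpa using ha0
  have hξξ : ⟪ξ, ξ⟫_ℝ ≠ 0 := by simpa using hξ0
  obtain ⟨b, hb0, hPb, hb⟩ := S.exists_fixed_orthogonal hn hdim a
  obtain ⟨η, hη0, hPη, hη⟩ := S.exists_antifixed_orthogonal hn hdim ξ
  have hΩa : ⟪Ω, a⟫_ℝ ≠ 0 := by rw [haΩ a hPa]; positivity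
  have hΩξ : ⟪Ω, ξ⟫_ℝ ≠ 0 := by rw [hξΩ ξ hPξ]; positivity
  have hΩb : ⟪Ω, b⟫_ℝ = 0 := by rw [haΩ b hPb, real_inner_comm, hb, mul_zero]
  have hΩη : ⟪Ω, η⟫_ℝ = 0 := by rw [hξΩ η hPη, real_inner_comm, hη, mul_zero]
  -- As $\theta(b) = \theta(\eta) = 0$, the first triple yields a multiple of $b$ with factor
  -- $\lambda + \mu$, the second a multiple of $\eta$ with factor $\lambda - \mu$.
  have h1 := hcyc a ξ b
  have h2 := hcyc a ξ η
  simp only [h.torsion_apply hLC, map_add, map_sub, map_smul, hPa, hPξ, hPb, theta_eq_inner,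
    ← hΩdef, inner_add_right, inner_sub_right, inner_smul_right, inner_neg_right, map_neg,
    hΩb] at h1
  simp only [h.torsion_apply hLC, map_add, map_sub, map_smul, hPa, hPξ, hPη, theta_eq_inner,
    ← hΩdef, inner_add_right, inner_sub_right, inner_smul_right, inner_neg_right, map_neg,
    hΩη] at h2
  have h3 : (⟪Ω, a⟫_ℝ * ⟪Ω, ξ⟫_ℝ * (lam + mu) / n) • b = 0 := by
    refine Eq.trans ?_ (congr(-$h1).trans neg_zero)
    module
  have h4 : (⟪Ω, a⟫_ℝ * ⟪Ω, ξ⟫_ℝ * (lam - mu) / n) • η = 0 := by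
    refine Eq.trans ?_ (congr(-$h2).trans neg_zero)
    module
  have h5 := (smul_eq_zero.1 h3).resolve_right hb0
  have h6 := (smul_eq_zero.1 h4).resolve_right hη0
  have h7 : lam + mu = 0 := by simpa [hΩa, hΩξ, hn0] using h5
  have h8 : lam - mu = 0 := by simpa [hΩa, hΩξ, hn0] using h6
  constructor <;> linarith

end Uniqueness

end W1Geometry

/-! ### Assembly of the cases -/

open W1Geometry in
theorem theorem5p3 {E : Type*} [NormedAddCommGroup E] [NormedSpace ℝ E] [FiniteDimensional ℝ E]
    {M : Type*} [TopologicalSpace M] [ChartedSpace E M] [IsManifold 𝓘(ℝ, E) ∞ M]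
    [ConnectedSpace M]
    [RiemannianBundle (fun x : M => TangentSpace 𝓘(ℝ, E) x)]
    [IsContMDiffRiemannianBundle 𝓘(ℝ, E) ∞ E (fun x : M => TangentSpace 𝓘(ℝ, E) x)]
    (n : ℕ) (hn : 1 ≤ n) (hdim : Module.finrank ℝ E = 2 * n)
    (S : AlmostProduct E M)
    (nab : LinearConnection E M) (hLC : IsLeviCivita nab)
    (hW1 : IsW1 n nab S)
    (nab' : LinearConnection E M) (hnat : IsNatural nab' S)
    (hfam : ∃ lam mu : ℝ, HasParameters n nab nab' S lam mu)
    (htor : HasParallelTorsion nab') (hcurv : HasRiemannianPCurvature nab' S) :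
    (∃ lam mu : ℝ, HasParameters n nab nab' S lam mu ∧
      ((lam = 0 ∧ mu = 0 ∧ ¬ WVanishes nab S ∧ ¬ IsW3bar n nab S ∧ ¬ IsW6bar n nab S) ∨
       (lam = 0 ∧ mu = 0 ∧ WVanishes nab S ∧ (IsW3bar n nab S ∨ IsW6bar n nab S)) ∨
       (lam = 0 ∧ mu ≠ 0 ∧ WVanishes nab S ∧ (IsW3bar n nab S ∨ IsW6bar n nab S)) ∨
       (lam ≠ 0 ∧ mu = 0 ∧ WVanishes nab S ∧ (IsW3bar n nab S ∨ IsW6bar n nab S)))) ∧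
    (2 ≤ n → ¬ WVanishes nab S →
      ∀ lam mu : ℝ, HasParameters n nab nab' S lam mu → lam = 0 ∧ mu = 0) := by
  refine ⟨?_, fun hn2 hW lam mu h =>
    h.eq_zero_of_not_wVanishes hLC hW1 hn2 hdim htor hcurv hW⟩
  obtain ⟨lam, mu, h⟩ := hfam
  by_cases hW : WVanishes nab S
  · have hΩ := smoothFieldAt_Omega (S := S) hLC hW1 hn hdim
    have hpar : ∀ p, nab' (Omega nab S) p = 0 := fun p =>
      h.nabla_Omega hLC hnat htor hn hdim (hΩ p)
    -- The pair can always be normalised to $\lambda = 0$, so the alternative with $\lambda \ne 0$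
    -- is never selected.
    suffices H : (∃ mu' : ℝ, HasParameters n nab nab' S 0 mu') ∧
        (IsW3bar n nab S ∨ IsW6bar n nab S) by
      obtain ⟨⟨mu', hmu'⟩, hcl⟩ := H
      refine ⟨0, mu', hmu', ?_⟩
      by_cases h0 : mu' = 0
      · exact Or.inr (Or.inl ⟨rfl, h0, hW, hcl⟩)
      · exact Or.inr (Or.inr (Or.inl ⟨rfl, h0, hW, hcl⟩))
    rcases P_Omega_of_wVanishes hnat hW hΩ hpar with hP | hP
    · exact ⟨⟨_, h.of_P_Omega (ε := 1) (by norm_num) (fun p => by rw [hP, one_smul])⟩,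
        Or.inr (isW6bar_of_fixed hW1 hP)⟩
    · exact ⟨⟨_, h.of_P_Omega (ε := -1) (by norm_num) (fun p => by rw [hP, neg_one_smul])⟩,
        Or.inl (isW3bar_of_antifixed hW1 hP)⟩
  -- Either class makes $\Omega$ an eigenvector of $P$ and hence $W = 0$, so both are excluded here.
  · refine ⟨0, 0, ?_, Or.inl ⟨rfl, rfl, hW, fun h3 => hW ?_, fun h6 => hW ?_⟩⟩
    · rcases hn.eq_or_lt with rfl | hn2
      · exact h.zero_of_dim_two (by omega)
      · obtain ⟨rfl, rfl⟩ := h.eq_zero_of_not_wVanishes hLC hW1 hn2 hdim htor hcurv hW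
        exact h
    · exact wVanishes_of_P_Omega (ε := -1) fun p => by
        rw [h3.P_Omega hW1 hn hdim, neg_one_smul]
    · exact wVanishes_of_P_Omega (ε := 1) fun p => by
        rw [h6.P_Omega hW1 hn hdim, one_smul]
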